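/- **Theorem 1.2.** There is an absolute constant $\kappa>0$, and for every $\lambda>0$ there is a constant $c=c(\lambda)\in(0,\infty)$ depending only on $\lambda$, such that the following holds for all integers $n\ge 0$ and $k\ge 1$. Let $X$ be an isotropic random vector in $\mathbb R^n$; that is, the law of $X$ is symmetric ($-X$ has the same law as $X$) and $\mathbb E\langle x,X\rangle^2=\|x\|_2^2$ for every $x\in\mathbb R^n$. Suppose that $$\Pr\big(|\langle x,X\rangle|\ge \lambda\|x\|_2\big)\ge \tfrac{99}{100}\qquad\text{for every }x\in\mathbb R^n .$$ Let $X_1,\dots,X_k$ be independent copies of $X$, let $e_1,\dots,e_k$ be the standard basis of $\mathbb R^k$, and let $\Gamma=k^{-1/2}\sum_{i=1}^k\langle X_i,\cdot\rangle e_i:\mathbb R^n\to\mathbb R^k$. Let $T\subset\mathbb R^n$ be a convex body, that is, a convex, centrally symmetric set with nonempty interior. Write $\|y\|_{T^\circ}=\sup_{t\in T}|\langle y,t\rangle|\in[0,\infty]$, let $G$ be the standard Gaussian vector in $\mathbb R^n$, and put $$r=\frac{c}{\sqrt k}\,\max\Big\{\mathbb E\|G\|_{T^\circ},\ \mathbb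 E\Big\|k^{-1/2}\sum_{i=1}^kX_i\Big\|_{T^\circ}\Big\}\in[0,\infty].$$ Then there is an event of probability at least $3/4$ on which $$\operatorname{diam}(T\cap\ker\Gamma)\le r\qquad\text{and}\qquad \|\Gamma x\|_2\ge\kappa\,\lambda\,\|x\|_2\ \text{ for every }x\in T\text{ with }\|x\|_2\ge r .$$ Here $\operatorname{diam}$ is the Euclidean diameter, with values in $[0,\infty]$. -/

import Mathlib

open MeasureTheory ProbabilityTheory
open scoped ENNReal RealInnerProductSpace

noncomputable section

/-- An isotropic measure on `ℝⁿ`: a Borel probability measure that is symmetric (invariant under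
`x ↦ -x`) and satisfies `∫ ⟨x, t⟩² dμ(t) = ‖x‖²` for every `x`. For `x ≠ 0` the right-hand side is
nonzero, so the equation includes integrability of `t ↦ ⟨x, t⟩²`. -/
structure IsIsotropic {n : ℕ} (μ : Measure (EuclideanSpace ℝ (Fin n))) : Prop where
  isProbabilityMeasure : IsProbabilityMeasure μ
  symm : μ.map (fun t => -t) = μ
  integral_sq : ∀ x : EuclideanSpace ℝ (Fin n), ∫ t, ⟪x, t⟫ ^ 2 ∂μ = ‖x‖ ^ 2

/-- A convex body in `ℝⁿ`: a convex, centrally symmetric set with nonempty interior. It is required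
neither to be closed nor to be bounded. -/
structure IsConvexBody {n : ℕ} (T : Set (EuclideanSpace ℝ (Fin n))) : Prop where
  convex : Convex ℝ T
  symm : ∀ x ∈ T, -x ∈ T
  interior_nonempty : (interior T).Nonempty

/-- The norm `‖y‖_{T°} = sup_{t ∈ T} |⟨y, t⟩|` whose unit ball is the polar of `T`, with values in
`[0, ∞]` since `T` may be unbounded. -/
def polarNorm {n : ℕ} (T : Set (EuclideanSpace ℝ (Fin n))) (y : EuclideanSpace ℝ (Fin n)) : ℝ≥0∞ :=
  ⨆ t ∈ T, ENNReal.ofReal |⟪y, t⟫|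

/-- The operator `Γ = k^{-1/2} ∑ᵢ ⟨vᵢ, ·⟩ eᵢ : ℝⁿ → ℝᵏ` with rows `k^{-1/2} vᵢ`. -/
def rowMatrix {n k : ℕ} (v : Fin k → EuclideanSpace ℝ (Fin n)) :
    EuclideanSpace ℝ (Fin n) →L[ℝ] EuclideanSpace ℝ (Fin k) :=
  (√(k : ℝ))⁻¹ • ∑ i, (innerSL ℝ (v i)).smulRight (EuclideanSpace.single i (1 : ℝ))

end

/-! This is a small-ball argument on a single sphere. Fix a radius `s` and truncate at `τ = lam *
s`: let `w_x = min (|⟪x, ·⟫| / τ) 1`. For `‖x‖ = s` the small-ball hypothesis gives `w_x` mean at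
least 99/100. If `∑ |⟪x, X_i⟫| < τ k / 2`, the empirical sum of the `w_x` falls short of its mean by
at least `49 k / 100`. Since the law is symmetric and `w_x` is a contraction of the odd function
`⟪x, ·⟫ / τ`, the expected largest shortfall is at most `2 √k / τ` times the expected polar norm of
`k^{-1/2} ∑ X_i` (`integral_pi_sup'_centered_le`). Markov's inequality makes failure unlikely.

Cauchy–Schwarz turns the `ℓ¹` lower bound into one for `‖Γ x‖`, and shrinking points of `T` towards
0 extends it to all norms `≥ s`. Kernel points of `T` then have norm at most `s`, so `r = 2 s`
bounds the diameter. The Gaussian term serves to keep `r` positive. -/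

/-! ### Symmetrization and contraction -/

/-- If `x`, `y` attain the left maxima, the increment `w x - w y` is at most `|u x - u y|`, and one
of the two ways of assigning `x`, `y` to the right maxima realizes this absolute value. -/
theorem sup'_add_add_sup'_sub_le {ι : Type*} (F : Finset ι) (hF : F.Nonempty) (a u w : ι → ℝ)
    (h : ∀ x y, |w x - w y| ≤ |u x - u y|) :
    F.sup' hF (fun x => a x + w x) + F.sup' hF (fun x => a x - w x) ≤
      F.sup' hF (fun x => a x + u x) + F.sup' hF (fun x => a x - u x) := by
  obtain ⟨x, hx, hx'⟩ := F.exists_mem_eq_sup' hF (fun x => a x + w x)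
  obtain ⟨y, hy, hy'⟩ := F.exists_mem_eq_sup' hF (fun x => a x - w x)
  rw [hx', hy']
  have h1 := F.le_sup' (fun x => a x + u x) hx
  have h2 := F.le_sup' (fun x => a x + u x) hy
  have h3 := F.le_sup' (fun x => a x - u x) hx
  have h4 := F.le_sup' (fun x => a x - u x) hy
  have h5 := (le_abs_self _).trans (h x y)
  rcases abs_cases (u x - u y) with h6 | h6 <;> linarith

theorem integrable_finset_sup' {ι α : Type*} [MeasurableSpace α] {μ : Measure α} (F : Finset ι)
    (hF : F.Nonempty) {f : ι → α → ℝ} (hf : ∀ x, Integrable (f x) μ) :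
    Integrable (fun v => F.sup' hF (fun x => f x v)) μ := by
  have : (fun v => F.sup' hF (fun x => f x v)) = F.sup' hF f := by
    ext v; rw [Finset.sup'_apply]
  rw [this]
  exact Finset.sup'_induction hF f (p := fun g => Integrable g μ) (fun _ h₁ _ h₂ => h₁.sup h₂)
    (fun x _ => hf x)

/-- One-coordinate symmetrization and contraction: in the expected maximum of a perturbed family,
a centred contraction of an odd family may be replaced by twice the family itself. -/
theorem integral_sup'_centered_le {ι E : Type*} [MeasurableSpace E] [InvolutiveNeg E]
    [MeasurableNeg E] {μ : Measure E} [IsProbabilityMeasure μ] (hsymm : μ.map (fun t => -t) = μ)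
    (F : Finset ι) (hF : F.Nonempty) {u w : ι → E → ℝ} (hu : ∀ x, Integrable (u x) μ)
    (hw : ∀ x, Integrable (w x) μ) (hodd : ∀ x v, u x (-v) = -u x v)
    (hlip : ∀ x y v, |w x v - w y v| ≤ |u x v - u y v|) (a : ι → ℝ) :
    ∫ v, F.sup' hF (fun x => a x + (∫ t, w x t ∂μ - w x v)) ∂μ ≤
      ∫ v, F.sup' hF (fun x => a x + 2 * u x v) ∂μ := by
  have ip : ∀ {f : ι → E → ℝ}, (∀ x, Integrable (f x) μ) →
      Integrable (fun v => F.sup' hF (fun x => a x + 2 * f x v)) μ := fun hf =>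
    integrable_finset_sup' F hF fun x => (integrable_const _).add ((hf x).const_mul 2)
  have im : ∀ {f : ι → E → ℝ}, (∀ x, Integrable (f x) μ) →
      Integrable (fun v => F.sup' hF (fun x => a x - 2 * f x v)) μ := fun hf =>
    integrable_finset_sup' F hF fun x => (integrable_const _).sub ((hf x).const_mul 2)
  have jensen : ∀ x ∈ F, a x + 2 * ∫ t, w x t ∂μ ≤
      ∫ v, F.sup' hF (fun x => a x + 2 * w x v) ∂μ := by
    intro x hx
    have : a x + 2 * ∫ t, w x t ∂μ = ∫ t, (a x + 2 * w x t) ∂μ := by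
      rw [integral_add (integrable_const _) ((hw x).const_mul 2), integral_const_mul]
      simp
    rw [this]
    exact integral_mono ((integrable_const _).add ((hw x).const_mul 2)) (ip hw)
      fun v => F.le_sup' (fun x => a x + 2 * w x v) hx
  have reflect : ∫ v, F.sup' hF (fun x => a x - 2 * u x v) ∂μ =
      ∫ v, F.sup' hF (fun x => a x + 2 * u x v) ∂μ := by
    have mp : MeasurePreserving (fun t : E => -t) μ μ := ⟨measurable_neg, hsymm⟩
    rw [← mp.integral_comp (MeasurableEquiv.neg E).measurableEmbedding]
    simp [hodd, sub_eq_add_neg]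
  -- By convexity: `a + m - w` is the midpoint of `a + 2 m` and `a - 2 w`, where `m` is the mean of
  -- `w`, and Jensen absorbs the first. This is where the factor 2 arises.
  calc ∫ v, F.sup' hF (fun x => a x + (∫ t, w x t ∂μ - w x v)) ∂μ
      ≤ ∫ v, (2⁻¹ * (∫ v, F.sup' hF (fun x => a x + 2 * w x v) ∂μ) +
          2⁻¹ * F.sup' hF (fun x => a x - 2 * w x v)) ∂μ := by
        refine integral_mono (integrable_finset_sup' F hF fun x => (integrable_const _).add
          ((integrable_const _).sub (hw x))) ((integrable_const _).add ((im hw).const_mul _)) ?_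
        intro v
        refine F.sup'_le hF _ fun x hx => ?_
        have h1 := jensen x hx
        have h2 := F.le_sup' (fun x => a x - 2 * w x v) hx
        dsimp only at h2 ⊢
        linarith
    _ = 2⁻¹ * ∫ v, (F.sup' hF (fun x => a x + 2 * w x v) +
          F.sup' hF (fun x => a x - 2 * w x v)) ∂μ := by
        rw [integral_add (integrable_const _) ((im hw).const_mul _), integral_const_mul,
          integral_add (ip hw) (im hw), mul_add, integral_const_mul]
        simp
    _ ≤ 2⁻¹ * ∫ v, (F.sup' hF (fun x => a x + 2 * u x v) +
          F.sup' hF (fun x => a x - 2 * u x v)) ∂μ := by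
        refine mul_le_mul_of_nonneg_left ?_ (by norm_num)
        refine integral_mono ((ip hw).add (im hw)) ((ip hu).add (im hu)) fun v => ?_
        refine sup'_add_add_sup'_sub_le F hF a (fun x => 2 * u x v) (fun x => 2 * w x v) ?_
        intro x y
        rw [← mul_sub, ← mul_sub, abs_mul, abs_mul]
        exact mul_le_mul_of_nonneg_left (hlip x y v) (abs_nonneg _)
    _ = ∫ v, F.sup' hF (fun x => a x + 2 * u x v) ∂μ := by
        rw [integral_add (ip hu) (im hu), reflect]
        ring

theorem integrable_comp_eval_pi {E : Type*} [MeasurableSpace E] {μ : Measure E}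
    [IsProbabilityMeasure μ] {k : ℕ} {f : E → ℝ} (hf : Integrable f μ) (i : Fin k) :
    Integrable (fun v : Fin k → E => f (v i)) (Measure.pi fun _ => μ) :=
  ((measurePreserving_eval (fun _ : Fin k => μ) i).integrable_comp hf.aestronglyMeasurable).2 hf

theorem measurePreserving_cons {E : Type*} [MeasurableSpace E] (μ : Measure E)
    [IsProbabilityMeasure μ] (k : ℕ) :
    MeasurePreserving (fun p : E × (Fin k → E) => (Fin.cons p.1 p.2 : Fin (k + 1) → E))
      (μ.prod (Measure.pi fun _ => μ)) (Measure.pi fun _ => μ) := by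
  have := (measurePreserving_piFinSuccAbove (fun _ : Fin (k + 1) => μ) 0).symm
  convert this using 1
  ext p : 1
  simp [MeasurableEquiv.piFinSuccAbove, Fin.consEquiv]

theorem measurableEmbedding_cons (E : Type*) [MeasurableSpace E] (k : ℕ) :
    MeasurableEmbedding (fun p : E × (Fin k → E) => (Fin.cons p.1 p.2 : Fin (k + 1) → E)) := by
  have := (MeasurableEquiv.piFinSuccAbove (fun _ : Fin (k + 1) => E) 0).symm.measurableEmbedding
  convert this using 1
  ext p : 1
  simp [MeasurableEquiv.piFinSuccAbove, Fin.consEquiv]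

/-- Symmetrization and contraction for sums of independent copies. -/
theorem integral_pi_sup'_centered_le {ι E : Type*} [MeasurableSpace E] [InvolutiveNeg E]
    [MeasurableNeg E] {μ : Measure E} [IsProbabilityMeasure μ] (hsymm : μ.map (fun t => -t) = μ)
    (F : Finset ι) (hF : F.Nonempty) {u w : ι → E → ℝ} (hu : ∀ x, Integrable (u x) μ)
    (hw : ∀ x, Integrable (w x) μ) (hodd : ∀ x v, u x (-v) = -u x v)
    (hlip : ∀ x y v, |w x v - w y v| ≤ |u x v - u y v|) (k : ℕ) (a : ι → ℝ) :
    ∫ v : Fin k → E, F.sup' hF (fun x => a x + ∑ i, (∫ t, w x t ∂μ - w x (v i)))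
        ∂(Measure.pi fun _ => μ) ≤
      ∫ v : Fin k → E, F.sup' hF (fun x => a x + ∑ i, 2 * u x (v i))
        ∂(Measure.pi fun _ => μ) := by
  induction k generalizing a with
  | zero => simp
  | succ k ih =>
    set m : ι → ℝ := fun x => ∫ t, w x t ∂μ with hm
    have iw0 : ∀ x, Integrable (fun t => m x - w x t) μ := fun x => (integrable_const _).sub (hw x)
    have iu0 : ∀ x, Integrable (fun t => 2 * u x t) μ := fun x => (hu x).const_mul 2
    have isum : ∀ {f : ι → E → ℝ}, (∀ x, Integrable (f x) μ) → ∀ x,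
        Integrable (fun v : Fin k → E => ∑ i, f x (v i)) (Measure.pi fun _ => μ) := fun hf x =>
      integrable_finsetSum _ fun i _ => integrable_comp_eval_pi (hf x) i
    let H : (ι → E → ℝ) → (ι → E → ℝ) → E → (Fin k → E) → ℝ := fun f g v0 v =>
      F.sup' hF (fun x => a x + (f x v0 + ∑ i, g x (v i)))
    have iH : ∀ {f g : ι → E → ℝ}, (∀ x, Integrable (f x) μ) → (∀ x, Integrable (g x) μ) →
        Integrable (fun p : E × (Fin k → E) => H f g p.1 p.2) (μ.prod (Measure.pi fun _ => μ)) :=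
      fun hf hg => integrable_finset_sup' F hF fun x =>
        (integrable_const _).add (((hf x).comp_fst _).add ((isum hg x).comp_snd _))
    let w' : ι → E → ℝ := fun x t => m x - w x t
    let u' : ι → E → ℝ := fun x t => 2 * u x t
    have iww : Integrable (fun p : E × (Fin k → E) => H w' w' p.1 p.2) _ := iH iw0 iw0
    have iwu : Integrable (fun p : E × (Fin k → E) => H w' u' p.1 p.2) _ := iH iw0 iu0
    have iuu : Integrable (fun p : E × (Fin k → E) => H u' u' p.1 p.2) _ := iH iu0 iu0
    rw [← (measurePreserving_cons μ k).integral_comp (measurableEmbedding_cons E k),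
      ← (measurePreserving_cons μ k).integral_comp (measurableEmbedding_cons E k)]
    simp only [Fin.sum_univ_succ, Fin.cons_zero, Fin.cons_succ]
    change ∫ p : E × (Fin k → E), H w' w' p.1 p.2 ∂(μ.prod (Measure.pi fun _ => μ)) ≤
      ∫ p : E × (Fin k → E), H u' u' p.1 p.2 ∂(μ.prod (Measure.pi fun _ => μ))
    rw [integral_prod _ iww, integral_prod_symm _ iuu]
    -- One block of coordinates is replaced at a time; the frozen terms are absorbed into the
    -- arbitrary offset `a`.
    calc ∫ v0, ∫ v, H w' w' v0 v ∂(Measure.pi fun _ => μ) ∂μ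
        ≤ ∫ v0, ∫ v, H w' u' v0 v ∂(Measure.pi fun _ => μ) ∂μ := by
          refine integral_mono iww.integral_prod_left iwu.integral_prod_left fun v0 => ?_
          simpa only [add_assoc] using ih (fun x => a x + (m x - w x v0))
      _ = ∫ v, ∫ v0, H w' u' v0 v ∂μ ∂(Measure.pi fun _ => μ) := integral_integral_swap iwu
      _ ≤ ∫ v, ∫ v0, H u' u' v0 v ∂μ ∂(Measure.pi fun _ => μ) := by
          refine integral_mono iwu.integral_prod_right iuu.integral_prod_right fun v => ?_
          have hcomm : ∀ p q r : ℝ, p + (q + r) = p + r + q := fun p q r => by ring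
          simp only [H, w', u', hcomm (a _)]
          exact integral_sup'_centered_le hsymm F hF hu hw hodd hlip
            (fun x => a x + ∑ i, 2 * u x (v i))

/-! ### Isotropic measures, polar norm and the operator `Γ` -/

theorem IsIsotropic.integrable_inner {n : ℕ} {μ : Measure (EuclideanSpace ℝ (Fin n))}
    (h : IsIsotropic μ) (x : EuclideanSpace ℝ (Fin n)) : Integrable (fun t => ⟪x, t⟫) μ := by
  have := h.isProbabilityMeasure
  rcases eq_or_ne x 0 with rfl | hx
  · simp
  have hsq : Integrable (fun t => ⟪x, t⟫ ^ 2) μ := by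
    -- A non-integrable square would have Bochner integral 0, forcing `x = 0`.
    by_contra hni
    have := h.integral_sq x
    rw [integral_undef hni] at this
    exact hx (by simpa using this.symm)
  have hm : AEStronglyMeasurable (fun t => ⟪x, t⟫) μ := by fun_prop
  exact ((memLp_two_iff_integrable_sq hm).2 hsq).integrable (by norm_num)

theorem le_polarNorm {n : ℕ} {T : Set (EuclideanSpace ℝ (Fin n))} {t : EuclideanSpace ℝ (Fin n)}
    (ht : t ∈ T) (y : EuclideanSpace ℝ (Fin n)) : ENNReal.ofReal |⟪y, t⟫| ≤ polarNorm T y :=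
  le_iSup₂_of_le t ht le_rfl

/-- The supremum may be uncountable, but a supremum of continuous functions is lower semicontinuous.
-/
theorem measurable_polarNorm {n : ℕ} (T : Set (EuclideanSpace ℝ (Fin n))) :
    Measurable (polarNorm T) := by
  refine LowerSemicontinuous.measurable ?_
  refine lowerSemicontinuous_iSup fun t => lowerSemicontinuous_iSup fun _ => ?_
  exact (ENNReal.continuous_ofReal.comp (by fun_prop)).lowerSemicontinuous

/-- Cauchy–Schwarz over the `k` coordinates. -/
theorem norm_rowMatrix_apply_ge {n k : ℕ} (v : Fin k → EuclideanSpace ℝ (Fin n))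
    (x : EuclideanSpace ℝ (Fin n)) : (∑ i, |⟪x, v i⟫|) / k ≤ ‖rowMatrix v x‖ := by
  have hcoord : ∀ j, rowMatrix v x j = (√(k : ℝ))⁻¹ * ⟪x, v j⟫ := by
    intro j
    simp [rowMatrix, real_inner_comm, Finset.sum_apply, Pi.single_apply]
  refine le_of_sq_le_sq ?_ (norm_nonneg _)
  rw [EuclideanSpace.real_norm_sq_eq]
  simp only [hcoord, mul_pow, inv_pow, Real.sq_sqrt (Nat.cast_nonneg k)]
  rw [← Finset.mul_sum, div_pow]
  rcases Nat.eq_zero_or_pos k with rfl | hk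
  · simp
  have hk' : (0 : ℝ) < k := by exact_mod_cast hk
  have := sq_sum_le_card_mul_sum_sq (s := Finset.univ) (f := fun i => |⟪x, v i⟫|)
  simp only [sq_abs, Finset.card_univ, Fintype.card_fin] at this
  rw [div_le_iff₀ (by positivity)]
  calc _ ≤ _ := this
    _ = _ := by field_simp

/-! ### Small-ball estimate on a sphere -/

/-- The truncation `u ↦ min (|u| / τ) 1` applied to the pairing with `x`. -/
noncomputable def truncatedInner {n : ℕ} (τ : ℝ) (x t : EuclideanSpace ℝ (Fin n)) : ℝ :=
  min |⟪x, t⟫ / τ| 1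

theorem integrable_truncatedInner {n : ℕ} (μ : Measure (EuclideanSpace ℝ (Fin n)))
    [IsProbabilityMeasure μ] (τ : ℝ) (x : EuclideanSpace ℝ (Fin n)) :
    Integrable (truncatedInner τ x) μ := by
  refine Integrable.of_bound (C := 1) ?_ (ae_of_all _ fun t => ?_)
  · unfold truncatedInner
    exact Continuous.aestronglyMeasurable (by fun_prop)
  · rw [truncatedInner, Real.norm_eq_abs, abs_of_nonneg (by positivity)]
    exact min_le_right _ _

theorem measureReal_le_integral_truncatedInner {n : ℕ} (μ : Measure (EuclideanSpace ℝ (Fin n)))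
    [IsProbabilityMeasure μ] {τ : ℝ} (hτ : 0 < τ) (x : EuclideanSpace ℝ (Fin n)) :
    μ.real {t | τ ≤ |⟪x, t⟫|} ≤ ∫ t, truncatedInner τ x t ∂μ := by
  have hms : MeasurableSet {t : EuclideanSpace ℝ (Fin n) | τ ≤ |⟪x, t⟫|} :=
    measurableSet_le measurable_const (by fun_prop)
  rw [← integral_indicator_one hms]
  refine integral_mono ((integrable_const (1 : ℝ)).indicator hms)
    (integrable_truncatedInner μ τ x) fun t => ?_
  by_cases ht : τ ≤ |⟪x, t⟫|
  · have : 1 ≤ |⟪x, t⟫ / τ| := by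
      rwa [abs_div, abs_of_pos hτ, le_div_iff₀ hτ, one_mul]
    simp [truncatedInner, ht, this]
  · rw [Set.indicator_of_notMem (by exact ht), truncatedInner]
    positivity

/-- Small-ball estimate on a finite set of vectors of norm `s`. -/
theorem measure_exists_sum_abs_inner_lt_le {n k : ℕ} {μ : Measure (EuclideanSpace ℝ (Fin n))}
    (hμ : IsIsotropic μ) {lam : ℝ} (hlam : 0 < lam)
    (hsb : ∀ x : EuclideanSpace ℝ (Fin n), 99 / 100 ≤ μ.real {y | lam * ‖x‖ ≤ |⟪x, y⟫|})
    (hk : 1 ≤ k) {T : Set (EuclideanSpace ℝ (Fin n))} {s : ℝ} (hs : 0 < s)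
    (F : Finset (EuclideanSpace ℝ (Fin n))) (hF : ∀ x ∈ F, x ∈ T ∧ ‖x‖ = s) :
    ENNReal.ofReal (49 / 100 * k) * (Measure.pi fun _ : Fin k => μ)
        {v | ∃ x ∈ F, ∑ i, |⟪x, v i⟫| < lam * s * k / 2} ≤
      ENNReal.ofReal (2 * √(k : ℝ) / (lam * s)) *
        ∫⁻ v, polarNorm T ((√(k : ℝ))⁻¹ • ∑ i, v i) ∂(Measure.pi fun _ : Fin k => μ) := by
  classical
  have := hμ.isProbabilityMeasure
  have hk' : (0 : ℝ) < k := by exact_mod_cast hk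
  have hτ : 0 < lam * s := by positivity
  set τ := lam * s with hτdef
  set ν := Measure.pi fun _ : Fin k => μ with hν
  -- Adding 0 makes both maxima nonnegative, so their integrals pass to `∫⁻`.
  set F₀ := insert (0 : EuclideanSpace ℝ (Fin n)) F with hF₀
  have hne : F₀.Nonempty := Finset.insert_nonempty _ _
  set u : EuclideanSpace ℝ (Fin n) → EuclideanSpace ℝ (Fin n) → ℝ := fun x t => ⟪x, t⟫ / τ with hu
  have iu : ∀ x, Integrable (u x) μ := fun x => (hμ.integrable_inner x).div_const _
  have iw : ∀ x, Integrable (truncatedInner τ x) μ := integrable_truncatedInner μ τ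
  have key := integral_pi_sup'_centered_le hμ.symm F₀ hne iu iw
    (by intro x v; simp [hu, neg_div])
    (by
      intro x y v
      exact (abs_min_sub_min_le_max _ _ _ _).trans
        (by simpa using abs_abs_sub_abs_le_abs_sub (u x v) (u y v))) k 0
  simp only [Pi.zero_apply, zero_add] at key
  set Y : (Fin k → EuclideanSpace ℝ (Fin n)) → ℝ := fun v => F₀.sup' hne
    (fun x => ∑ i, (∫ t, truncatedInner τ x t ∂μ - truncatedInner τ x (v i))) with hY
  have iY : Integrable Y ν := integrable_finset_sup' F₀ hne fun x =>
    integrable_finsetSum _ fun i _ =>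
      integrable_comp_eval_pi ((integrable_const _).sub (iw x)) i
  have iZ : Integrable (fun v : Fin k → EuclideanSpace ℝ (Fin n) =>
      F₀.sup' hne (fun x => ∑ i, 2 * u x (v i))) ν := integrable_finset_sup' F₀ hne fun x =>
    integrable_finsetSum _ fun i _ => integrable_comp_eval_pi ((iu x).const_mul 2) i
  have hY0 : ∀ v, 0 ≤ Y v := by
    intro v
    refine le_trans (le_of_eq ?_) (F₀.le_sup' (fun x => ∑ i, (∫ t, truncatedInner τ x t ∂μ -
      truncatedInner τ x (v i))) (Finset.mem_insert_self 0 F))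
    simp [truncatedInner]
  have hZ0 : ∀ v : Fin k → EuclideanSpace ℝ (Fin n),
      0 ≤ F₀.sup' hne (fun x => ∑ i, 2 * u x (v i)) := by
    intro v
    refine le_trans (le_of_eq ?_)
      (F₀.le_sup' (fun x => ∑ i, 2 * u x (v i)) (Finset.mem_insert_self 0 F))
    simp [hu]
  -- On the bad event the shortfall is at least `(99/100 - 1/2) k`.
  have hsub : {v : Fin k → EuclideanSpace ℝ (Fin n) | ∃ x ∈ F, ∑ i, |⟪x, v i⟫| < τ * k / 2} ⊆
      {v | ENNReal.ofReal (49 / 100 * k) ≤ ENNReal.ofReal (Y v)} := by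
    rintro v ⟨x, hx, hlt⟩
    refine ENNReal.ofReal_le_ofReal ?_
    refine le_trans ?_ (F₀.le_sup' (fun x => ∑ i, (∫ t, truncatedInner τ x t ∂μ -
      truncatedInner τ x (v i))) (Finset.mem_insert_of_mem hx))
    have h1 : 99 / 100 ≤ ∫ t, truncatedInner τ x t ∂μ := by
      refine (hsb x).trans ?_
      rw [(hF x hx).2]
      exact measureReal_le_integral_truncatedInner μ hτ x
    have h2 : ∑ i, truncatedInner τ x (v i) ≤ k / 2 := by
      calc _ ≤ ∑ i, |⟪x, v i⟫| / τ := Finset.sum_le_sum fun i _ => by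
            rw [truncatedInner, abs_div, abs_of_pos hτ]; exact min_le_left _ _
        _ ≤ k / 2 := by
            rw [← Finset.sum_div, div_le_iff₀ hτ]; linarith
    simp only [Finset.sum_sub_distrib, Finset.sum_const, Finset.card_univ, Fintype.card_fin,
      nsmul_eq_mul]
    nlinarith
  calc _ ≤ ENNReal.ofReal (49 / 100 * k) *
        ν {v | ENNReal.ofReal (49 / 100 * k) ≤ ENNReal.ofReal (Y v)} := by gcongr
    _ ≤ ∫⁻ v, ENNReal.ofReal (Y v) ∂ν :=
        mul_meas_ge_le_lintegral₀ iY.aemeasurable.ennreal_ofReal _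
    _ = ENNReal.ofReal (∫ v, Y v ∂ν) :=
        (ofReal_integral_eq_lintegral_ofReal iY (ae_of_all _ hY0)).symm
    _ ≤ ENNReal.ofReal (∫ v, F₀.sup' hne (fun x => ∑ i, 2 * u x (v i)) ∂ν) :=
        ENNReal.ofReal_le_ofReal key
    _ = ∫⁻ v, ENNReal.ofReal (F₀.sup' hne (fun x => ∑ i, 2 * u x (v i))) ∂ν :=
        ofReal_integral_eq_lintegral_ofReal iZ (ae_of_all _ hZ0)
    _ ≤ ∫⁻ v, ENNReal.ofReal (2 * √(k : ℝ) / τ) * polarNorm T ((√(k : ℝ))⁻¹ • ∑ i, v i) ∂ν := by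
        refine lintegral_mono fun v => ?_
        obtain ⟨x, hx, hx'⟩ := F₀.exists_mem_eq_sup' hne (fun x => ∑ i, 2 * u x (v i))
        dsimp only
        rw [hx']
        rcases Finset.mem_insert.1 hx with rfl | hxF
        · simp [hu]
        refine le_trans ?_ (mul_le_mul_right (le_polarNorm (hF x hxF).1 _) _)
        rw [← ENNReal.ofReal_mul (by positivity)]
        refine ENNReal.ofReal_le_ofReal ?_
        refine le_trans (le_of_eq ?_) (mul_le_mul_of_nonneg_left (le_abs_self _) (by positivity))
        have : √(k : ℝ) ≠ 0 := by positivity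
        rw [real_inner_smul_left, real_inner_comm, inner_sum, ← Finset.mul_sum, ← Finset.sum_div]
        field_simp
    _ = _ := lintegral_const_mul _ ((measurable_polarNorm T).comp (by fun_prop))

/-- The vectors `v` whose pairings with all points of `T` of norm `s` are large on average. -/
def largeOnSphere {n : ℕ} (k : ℕ) (T : Set (EuclideanSpace ℝ (Fin n))) (lam s : ℝ) :
    Set (Fin k → EuclideanSpace ℝ (Fin n)) :=
  {v | ∀ x ∈ T, ‖x‖ = s → lam * s * k / 2 ≤ ∑ i, |⟪x, v i⟫|}

theorem isClosed_largeOnSphere {n : ℕ} (k : ℕ) (T : Set (EuclideanSpace ℝ (Fin n))) (lam s : ℝ) :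
    IsClosed (largeOnSphere k T lam s) := by
  simp only [largeOnSphere, Set.ofPred_forall]
  exact isClosed_iInter fun x => isClosed_iInter fun _ => isClosed_iInter fun _ =>
    isClosed_le continuous_const (by fun_prop)

/-- Failure at a point is an open condition on that point, so it already occurs on a countable dense
subset of the slice. The finite-set bound is uniform and passes to the increasing union. -/
theorem measure_compl_largeOnSphere_le {n k : ℕ} {μ : Measure (EuclideanSpace ℝ (Fin n))}
    (hμ : IsIsotropic μ) {lam : ℝ} (hlam : 0 < lam)
    (hsb : ∀ x : EuclideanSpace ℝ (Fin n), 99 / 100 ≤ μ.real {y | lam * ‖x‖ ≤ |⟪x, y⟫|})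
    (hk : 1 ≤ k) {T : Set (EuclideanSpace ℝ (Fin n))} {s : ℝ} (hs : 0 < s)
    (hT : ∫⁻ v, polarNorm T ((√(k : ℝ))⁻¹ • ∑ i, v i) ∂(Measure.pi fun _ : Fin k => μ) ≤
      ENNReal.ofReal (s * √(k : ℝ) * lam / 20)) :
    (Measure.pi fun _ : Fin k => μ) (largeOnSphere k T lam s)ᶜ ≤ ENNReal.ofReal (1 / 4) := by
  classical
  have := hμ.isProbabilityMeasure
  have hk' : (0 : ℝ) < k := by exact_mod_cast hk
  set S : Set (EuclideanSpace ℝ (Fin n)) := {x | x ∈ T ∧ ‖x‖ = s} with hS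
  rcases S.eq_empty_or_nonempty with hSe | hSne
  · have : (largeOnSphere k T lam s)ᶜ = ∅ := by
      rw [Set.compl_empty_iff, Set.eq_univ_iff_forall]
      intro v x hx hxs
      exact absurd (show x ∈ S from ⟨hx, hxs⟩) (by simp [hSe])
    simp [this]
  have : Nonempty S := hSne.to_subtype
  set d : ℕ → EuclideanSpace ℝ (Fin n) := fun i => TopologicalSpace.denseSeq S i with hd
  set F : ℕ → Finset (EuclideanSpace ℝ (Fin n)) := fun m => (Finset.range m).image d with hFdef
  set B : ℕ → Set (Fin k → EuclideanSpace ℝ (Fin n)) := fun m =>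
    {v | ∃ x ∈ F m, ∑ i, |⟪x, v i⟫| < lam * s * k / 2} with hB
  have hcover : (largeOnSphere k T lam s)ᶜ ⊆ ⋃ m, B m := by
    intro v hv
    simp only [largeOnSphere, Set.mem_compl_iff, Set.mem_ofPred_eq, not_forall, not_le] at hv
    obtain ⟨x, hxT, hxs, hlt⟩ := hv
    have hopen : IsOpen {y : S | ∑ i, |⟪(y : EuclideanSpace ℝ (Fin n)), v i⟫| < lam * s * k / 2} :=
      isOpen_lt (by fun_prop) continuous_const
    obtain ⟨_, hy, j, rfl⟩ := (TopologicalSpace.denseRange_denseSeq S).inter_open_nonempty _ hopen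
      ⟨⟨x, hxT, hxs⟩, hlt⟩
    exact Set.mem_iUnion.2 ⟨j + 1, d j, Finset.mem_image_of_mem d (by simp), hy⟩
  have hmono : Monotone B := by
    rintro a b hab v ⟨x, hx, hlt⟩
    exact ⟨x, Finset.image_subset_image (Finset.range_mono hab) hx, hlt⟩
  refine (measure_mono hcover).trans ?_
  rw [hmono.measure_iUnion]
  refine iSup_le fun m => ?_
  have hle := measure_exists_sum_abs_inner_lt_le hμ hlam hsb hk (T := T) hs (F m) (by
    intro x hx
    obtain ⟨j, -, rfl⟩ := Finset.mem_image.1 hx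
    exact (TopologicalSpace.denseSeq S j).2)
  have hle' : ENNReal.ofReal (49 / 100 * k) * (Measure.pi fun _ : Fin k => μ) (B m) ≤
      ENNReal.ofReal (49 / 100 * k) * ENNReal.ofReal (1 / 4) := by
    refine hle.trans ((mul_le_mul_right hT _).trans ?_)
    rw [← ENNReal.ofReal_mul (by positivity), ← ENNReal.ofReal_mul (by positivity)]
    refine ENNReal.ofReal_le_ofReal ?_
    have hsq : √(k : ℝ) * √(k : ℝ) = k := Real.mul_self_sqrt hk'.le
    -- The 20 suffices because `1/10 ≤ 49/100 * 1/4`.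
    have : 2 * √(k : ℝ) / (lam * s) * (s * √(k : ℝ) * lam / 20) = k / 10 := by
      field_simp
      nlinarith
    rw [this]
    linarith
  exact (ENNReal.mul_le_mul_iff_right (by simp; omega) ENNReal.ofReal_ne_top).1 hle'

/-! ### From the sphere to the convex body -/

theorem IsConvexBody.smul_mem {n : ℕ} {T : Set (EuclideanSpace ℝ (Fin n))} (hT : IsConvexBody T)
    {x : EuclideanSpace ℝ (Fin n)} (hx : x ∈ T) {a : ℝ} (ha : 0 ≤ a) (ha1 : a ≤ 1) :
    a • x ∈ T := by
  have h := hT.convex hx (hT.symm x hx) (a := (1 + a) / 2) (b := (1 - a) / 2)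
    (by linarith) (by linarith) (by ring)
  convert h using 1
  module

/-- Otherwise `⟪t, G⟫` would vanish almost surely for some nonzero `t ∈ T`, though its variance is
`‖t‖²`. -/
theorem IsConvexBody.lintegral_polarNorm_stdGaussian_ne_zero {n : ℕ} (hn : n ≠ 0)
    {T : Set (EuclideanSpace ℝ (Fin n))} (hT : IsConvexBody T) :
    ∫⁻ g, polarNorm T g ∂(stdGaussian (EuclideanSpace ℝ (Fin n))) ≠ 0 := by
  intro h0
  rw [lintegral_eq_zero_iff (measurable_polarNorm T)] at h0
  have : Nontrivial (EuclideanSpace ℝ (Fin n)) := by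
    have : Nonempty (Fin n) := ⟨⟨0, Nat.pos_of_ne_zero hn⟩⟩
    infer_instance
  obtain ⟨t, htT, ht0⟩ : ∃ t ∈ T, t ≠ 0 := by
    by_contra! hc
    obtain ⟨y, hy⟩ := hT.interior_nonempty
    have hsub : T ⊆ {0} := fun t ht => hc t ht
    have := interior_mono hsub hy
    simp at this
  have hL : (innerSL ℝ t : EuclideanSpace ℝ (Fin n) → ℝ)
      =ᵐ[stdGaussian (EuclideanSpace ℝ (Fin n))] fun _ => 0 := by
    filter_upwards [h0] with g hg
    have := (le_polarNorm htT g).trans hg.le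
    rw [innerSL_apply_apply, real_inner_comm]
    simpa using this
  have hvar := variance_dual_stdGaussian (innerSL ℝ t)
  rw [variance_congr hL, ← covariance_self (by fun_prop), covariance_const_left, innerSL_apply_norm] at hvar
  exact ht0 (by simpa using hvar.symm)

theorem hasLaw_pi {n k : ℕ} {μ : Measure (EuclideanSpace ℝ (Fin n))}
    {Ω : Type*} [MeasurableSpace Ω] {P : Measure Ω} [IsProbabilityMeasure P]
    {X : Fin k → Ω → EuclideanSpace ℝ (Fin n)} (hX : ∀ i, HasLaw (X i) μ P) (hind : iIndepFun X P) :
    HasLaw (fun ω i => X i ω) (Measure.pi fun _ => μ) P := by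
  have hm : ∀ i, AEMeasurable (X i) P := fun i => (hX i).aemeasurable
  refine ⟨aemeasurable_pi_lambda _ hm, ?_⟩
  rw [(iIndepFun_iff_map_fun_eq_pi_map hm).1 hind]
  simp only [(hX _).map_eq]

/-- Rescale `x` to norm `s`, which stays in `T`; both sides are homogeneous. -/
theorem norm_rowMatrix_ge_of_mem_largeOnSphere {n k : ℕ} (hk : 1 ≤ k)
    {T : Set (EuclideanSpace ℝ (Fin n))} (hT : IsConvexBody T) {lam s : ℝ} (hs : 0 < s)
    {v : Fin k → EuclideanSpace ℝ (Fin n)} (hv : v ∈ largeOnSphere k T lam s)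
    {x : EuclideanSpace ℝ (Fin n)} (hx : x ∈ T) (hsx : s ≤ ‖x‖) :
    1 / 2 * lam * ‖x‖ ≤ ‖rowMatrix v x‖ := by
  have hx0 : 0 < ‖x‖ := hs.trans_le hsx
  have hk' : (0 : ℝ) < k := by exact_mod_cast hk
  refine le_trans ?_ (norm_rowMatrix_apply_ge v x)
  have h := hv ((s / ‖x‖) • x) (hT.smul_mem hx (by positivity) ((div_le_one hx0).2 hsx))
    (by rw [norm_smul, Real.norm_of_nonneg (by positivity)]; field_simp)
  simp only [real_inner_smul_left, abs_mul, abs_of_pos (div_pos hs hx0)] at h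
  rw [← Finset.mul_sum] at h
  rw [le_div_iff₀ hk']
  have h2 : lam * s * k / 2 = s / ‖x‖ * (1 / 2 * lam * ‖x‖ * k) := by field_simp
  rw [h2] at h
  exact le_of_mul_le_mul_left h (by positivity)

/-- The constant `κ` is absolute and `c` depends only on `lam`. The event `A` is a measurable set of
probability at least `3/4` on which both the diameter bound and the lower bound for `Γ` hold. -/
theorem theorem1p2 :
    ∃ κ : ℝ, 0 < κ ∧ ∀ lam : ℝ, 0 < lam → ∃ c : ℝ, 0 < c ∧
      ∀ (n k : ℕ), 1 ≤ k →
      ∀ (μ : Measure (EuclideanSpace ℝ (Fin n))), IsIsotropic μ →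
        (∀ x : EuclideanSpace ℝ (Fin n), 99 / 100 ≤ μ.real {y | lam * ‖x‖ ≤ |⟪x, y⟫|}) →
      ∀ (Ω : Type*) [MeasurableSpace Ω] (P : Measure Ω) [IsProbabilityMeasure P]
        (X : Fin k → Ω → EuclideanSpace ℝ (Fin n)),
        (∀ i, HasLaw (X i) μ P) → iIndepFun X P →
      ∀ T : Set (EuclideanSpace ℝ (Fin n)), IsConvexBody T →
      ∀ r : ℝ≥0∞,
        r = ENNReal.ofReal (c / √(k : ℝ)) *
          max (∫⁻ g, polarNorm T g ∂(stdGaussian (EuclideanSpace ℝ (Fin n))))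
            (∫⁻ ω, polarNorm T ((√(k : ℝ))⁻¹ • ∑ i, X i ω) ∂P) →
      ∃ A : Set Ω, MeasurableSet A ∧ 3 / 4 ≤ P.real A ∧ ∀ ω ∈ A,
        Metric.ediam (T ∩ (LinearMap.ker (rowMatrix (fun i => X i ω)).toLinearMap : Set (EuclideanSpace ℝ (Fin n)))) ≤ r ∧
        ∀ x ∈ T, r ≤ ENNReal.ofReal ‖x‖ →
          κ * lam * ‖x‖ ≤ ‖rowMatrix (fun i => X i ω) x‖ := by
  -- With `r = 2 s`, the value `c = 40 / lam` gives exactly the bound `s √k lam / 20` on the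
  -- expected polar norm.
  refine ⟨1 / 2, by norm_num, fun lam hlam => ⟨40 / lam, by positivity, ?_⟩⟩
  intro n k hk μ hμ hsb Ω _ P _ X hX hind T hT r hr
  have := hμ.isProbabilityMeasure
  have hk' : (0 : ℝ) < k := by exact_mod_cast hk
  have hsk : 0 < √(k : ℝ) := Real.sqrt_pos.2 hk'
  -- In dimension 0 the radius vanishes and no sphere is available, but all claims are trivial.
  rcases eq_or_ne n 0 with rfl | hn
  · refine ⟨Set.univ, MeasurableSet.univ, by simp; norm_num, fun ω _ => ⟨?_, fun x _ _ => ?_⟩⟩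
    · rw [Metric.ediam_subsingleton (Set.subsingleton_of_subsingleton)]
      exact zero_le
    · simp [Subsingleton.elim x 0]
  rcases eq_or_ne r ⊤ with rfl | hrtop
  · exact ⟨Set.univ, MeasurableSet.univ, by simp; norm_num, fun ω _ =>
      ⟨le_top, fun x _ h => absurd h (by simp)⟩⟩
  have hr0 : r ≠ 0 := by
    rw [hr]
    refine mul_ne_zero (by simp; positivity) ?_
    exact ((pos_iff_ne_zero.2 (hT.lintegral_polarNorm_stdGaussian_ne_zero hn)).trans_le
      (le_max_left _ _)).ne'
  have hrpos : 0 < r.toReal := ENNReal.toReal_pos hr0 hrtop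
  set s := r.toReal / 2 with hs_def
  have hs : 0 < s := by positivity
  have hrs : r = ENNReal.ofReal (2 * s) := by
    rw [hs_def, mul_div_cancel₀ _ (two_ne_zero), ENNReal.ofReal_toReal hrtop]
  have hlaw := hasLaw_pi hX hind
  have hM : ∫⁻ v, polarNorm T ((√(k : ℝ))⁻¹ • ∑ i, v i) ∂(Measure.pi fun _ : Fin k => μ) ≤
      ENNReal.ofReal (s * √(k : ℝ) * lam / 20) := by
    have hmeas : Measurable fun v : Fin k → EuclideanSpace ℝ (Fin n) =>
        polarNorm T ((√(k : ℝ))⁻¹ • ∑ i, v i) := (measurable_polarNorm T).comp (by fun_prop)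
    rw [← hlaw.map_eq, lintegral_map' hmeas.aemeasurable hlaw.aemeasurable]
    have hle : ENNReal.ofReal (40 / lam / √(k : ℝ)) *
        ∫⁻ ω, polarNorm T ((√(k : ℝ))⁻¹ • ∑ i, X i ω) ∂P ≤
        ENNReal.ofReal (40 / lam / √(k : ℝ)) * ENNReal.ofReal (s * √(k : ℝ) * lam / 20) := by
      rw [← ENNReal.ofReal_mul (by positivity)]
      have : 40 / lam / √(k : ℝ) * (s * √(k : ℝ) * lam / 20) = 2 * s := by
        field_simp
        norm_num
      rw [this, ← hrs, hr]
      gcongr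
      exact le_max_right _ _
    exact (ENNReal.mul_le_mul_iff_right (by simp; positivity) ENNReal.ofReal_ne_top).1 hle
  set ν := Measure.pi fun _ : Fin k => μ with hν
  set G := largeOnSphere k T lam s with hG
  have hGm : MeasurableSet G := (isClosed_largeOnSphere k T lam s).measurableSet
  have hνG : 3 / 4 ≤ ν.real G := by
    have h1 : ν.real Gᶜ ≤ 1 / 4 :=
      ENNReal.toReal_le_of_le_ofReal (by norm_num)
        (measure_compl_largeOnSphere_le hμ hlam hsb hk hs hM)
    rw [probReal_compl_eq_one_sub hGm] at h1
    linarith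
  -- The `X i` are only almost everywhere measurable, so the preimage of `G` is replaced by a
  -- measurable subset of equal measure.
  obtain ⟨A, hAsub, hAm, hAeq⟩ :=
    (hlaw.aemeasurable.nullMeasurableSet_preimage hGm).exists_measurable_subset_ae_eq
  refine ⟨A, hAm, ?_, fun ω hω => ?_⟩
  · rw [measureReal_congr hAeq]
    exact hνG.trans_eq (hlaw.measureReal_eq (p := fun v => v ∈ G) hGm).symm
  have hωG : (fun i => X i ω) ∈ G := hAsub hω
  constructor
  · have hball : ∀ x ∈ T ∩ (LinearMap.ker (rowMatrix (fun i => X i ω)).toLinearMap :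
        Set (EuclideanSpace ℝ (Fin n))), ‖x‖ ≤ s := by
      rintro x ⟨hxT, hxk⟩
      by_contra! hlt
      have h := norm_rowMatrix_ge_of_mem_largeOnSphere hk hT hs hωG hxT hlt.le
      have h0 : rowMatrix (fun i => X i ω) x = 0 := hxk
      rw [h0, norm_zero] at h
      have : 0 < ‖x‖ := hs.trans hlt
      have : 0 < 1 / 2 * lam * ‖x‖ := by positivity
      linarith
    rw [hrs]
    refine Metric.ediam_le fun x hx y hy => ?_
    rw [edist_dist]
    refine ENNReal.ofReal_le_ofReal ?_
    have := dist_le_norm_add_norm x y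
    linarith [hball x hx, hball y hy]
  · intro x hxT hrx
    rw [hrs, ENNReal.ofReal_le_ofReal_iff (norm_nonneg _)] at hrx
    exact norm_rowMatrix_ge_of_mem_largeOnSphere hk hT hs hωG hxT (by linarith)
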